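/- All games are games of perfect information, and a strategy may depend on all the preceding moves. **Games.** In the determination game $DG(X)$ on a topological space $X$, two players $\Sigma$ and $\Omega$ alternately choose non-empty sets $A_1\supseteq B_1\supseteq A_2\supseteq B_2\supseteq\cdots$: $\Sigma$ chooses any non-empty $A_1\subseteq X$ and, for $n\ge 2$, any non-empty $A_n\subseteq B_{n-1}$; $\Omega$ answers by a non-empty relatively open subset $B_n$ of $A_n$. The player $\Omega$ wins if $K=\bigcap_{n}\overline{A_n}$ is compact and either $K=\emptyset$ or every neighborhood of $K$ in $X$ contains all but finitely many of the sets $A_n$. The space $X$ is *game determined* if $\Omega$ has a winning strategy in $DG(X)$. In the Choquet game on $X$, the players $\alpha$ and $\beta$ choose open sets $X=U_0\supseteq V_0\supseteq U_1\supseteq V_1\supseteq\cdots$, where $\alpha$ chooses the $U_n$ (its first move being $U_0=X$), $\beta$ chooses the $V_n$, and all the sets $V_n$ $(n\ge 0)$ and $U_n$ $(n\ge 1)$ must be non-empty; $\alpha$ wins if $\bigcap_n U_n\neq\emptyset$. The space $X$ is *Choquet* if $\alpha$ has a winning strategy. **Fragmentability.** $X$ is *fragmentable* if there is a metric $d$ on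 the set $X$ (not assumed to be related to the topology) such that for every $\varepsilon>0$ every non-empty $A\subseteq X$ has a non-empty relatively open subset of $d$-diameter $<\varepsilon$. **Stegall spaces.** An *usco map* $\Phi:Z\multimap X$ between topological spaces assigns to each $z\in Z$ a non-empty compact set $\Phi(z)\subseteq X$ so that $\{z\in Z:\Phi(z)\subseteq U\}$ is open in $Z$ for every open $U\subseteq X$. It is *minimal* if $\Psi=\Phi$ for every usco map $\Psi:Z\multimap X$ with $\Psi(z)\subseteq\Phi(z)$ for all $z\in Z$. For a class $\mathcal C$ of Baire spaces, $X$ is *$\mathcal C$-Stegall* if for every non-empty $Z\in\mathcal C$ every minimal usco map $\Phi:Z\multimap X$ is single-valued at some point, that is, $\Phi(z)$ is a singleton for some $z\in Z$. The *weight* $w(X)$ is the least cardinality of a base of the topology of $X$, the *density* of a space is the least cardinality of a dense subset, and a space is *Baire* if the intersection of any sequence of dense open sets is dense. **Theorem.** Let $X$ be a game determined Tychonoff space, and let $\mathcal C$ be the class of all Baire metrizable spaces of density $\le w(X)$. 1. If $X$ is Baire and fragmentable, then $X$ contains a dense $G_\delta$-subset which is metrizable in the subspace topology. 2. If $X$ is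 Baire and $\mathcal C$-Stegall, then $X$ contains a dense subspace which is metrizable and Baire. 3. If $X$ is Choquet and $\mathcal C$-Stegall, then $X$ contains a dense subspace which is completely metrizable. -/

import Mathlib

open Set Filter Topology

universe u

/-! ### Cardinal functions -/

/-- The weight `w(X)`: the least cardinality of a base of the topology. -/
noncomputable def topWeight (X : Type u) [TopologicalSpace X] : Cardinal.{u} :=
  sInf {κ | ∃ B : Set (Set X), TopologicalSpace.IsTopologicalBasis B ∧ Cardinal.mk B = κ}

/-- The density `d(X)`: the least cardinality of a dense subset. -/
noncomputable def topDensity (X : Type u) [TopologicalSpace X] : Cardinal.{u} :=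
  sInf {κ | ∃ D : Set X, Dense D ∧ Cardinal.mk D = κ}

/-! ### Usco maps and Stegall spaces -/

/-- A multi-valued map with non-empty compact values which is upper semicontinuous
(see `isUsco_iff` for the formulation through open sets). -/
def IsUsco {Z X : Type*} [TopologicalSpace Z] [TopologicalSpace X] (Φ : Z → Set X) : Prop :=
  (∀ z, (Φ z).Nonempty ∧ IsCompact (Φ z)) ∧ UpperHemicontinuous Φ

theorem isUsco_iff {Z X : Type*} [TopologicalSpace Z] [TopologicalSpace X] (Φ : Z → Set X) :
    IsUsco Φ ↔ (∀ z, (Φ z).Nonempty ∧ IsCompact (Φ z)) ∧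
      ∀ U : Set X, IsOpen U → IsOpen {z | Φ z ⊆ U} := by
  refine and_congr_right fun _ => ?_
  rw [upperHemicontinuous_iff]
  constructor
  · intro h U hU
    rw [isOpen_iff_mem_nhds]
    intro z hz
    filter_upwards [upperHemicontinuousAt_iff.1 (h z) U (hU.mem_nhdsSet.2 hz)] with z' hz'
    exact hU.mem_nhdsSet.1 hz'
  · intro h z
    rw [upperHemicontinuousAt_iff]
    intro t ht
    obtain ⟨U, hU, hzU, hUt⟩ := mem_nhdsSet_iff_exists.1 ht
    filter_upwards [(h U hU).mem_nhds hzU] with z' hz'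
    exact mem_nhdsSet_iff_exists.2 ⟨U, hU, hz', hUt⟩

/-- An usco map is minimal if it contains no other usco map. -/
def IsMinimalUsco {Z X : Type*} [TopologicalSpace Z] [TopologicalSpace X]
    (Φ : Z → Set X) : Prop :=
  IsUsco Φ ∧ ∀ Ψ : Z → Set X, IsUsco Ψ → (∀ z, Ψ z ⊆ Φ z) → Φ = Ψ

/-- `X` is `C`-Stegall: every minimal usco map from a non-empty space `Z` of the class `C`
to `X` is single-valued at some point of `Z`. -/
def IsStegallFor (C : ∀ (Z : Type u) [TopologicalSpace Z], Prop)
    (X : Type u) [TopologicalSpace X] : Prop :=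
  ∀ (Z : Type u) [TopologicalSpace Z], C Z → Nonempty Z →
    ∀ Φ : Z → Set X, IsMinimalUsco Φ → ∃ (z : Z) (x : X), Φ z = {x}

/-- The class of Baire metrizable spaces of density at most `κ`. A metrizable space of density
at most `κ : Cardinal.{u}` is homeomorphic to a space in `Type u`, so no space is lost by
fixing the universe. -/
def BaireMetrizableOfDensityLE (κ : Cardinal.{u}) (Z : Type u) [TopologicalSpace Z] : Prop :=
  BaireSpace Z ∧ TopologicalSpace.MetrizableSpace Z ∧ topDensity Z ≤ κ

/-! ### Fragmentable spaces -/

/-- The metric `m` (in general unrelated to the topology) fragments `X`: every non-empty `A`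
has non-empty relatively open subsets `A ∩ U` of arbitrarily small `m`-diameter. -/
def IsFragmentedBy (X : Type*) [TopologicalSpace X] (m : MetricSpace X) : Prop :=
  ∀ ε : ENNReal, 0 < ε → ∀ A : Set X, A.Nonempty →
    ∃ U : Set X, IsOpen U ∧ (A ∩ U).Nonempty ∧
      @Metric.ediam X m.toPseudoMetricSpace.toPseudoEMetricSpace (A ∩ U) < ε

/-- `X` is fragmented by some metric. -/
def IsFragmentable (X : Type*) [TopologicalSpace X] : Prop :=
  ∃ m : MetricSpace X, IsFragmentedBy X m

/-! ### The determination game -/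

/-- A strategy of the player `Ω` in the determination game on `X`. Given the list
`(A₁, B₁), …, (Aₙ₋₁, Bₙ₋₁)` of the previous rounds and the non-empty set `Aₙ` just played
by `Σ`, it answers by a non-empty relatively open subset `Bₙ` of `Aₙ`.
(Its values on lists that are not legal positions are never used.) -/
structure DeterminationStrategy (X : Type*) [TopologicalSpace X] where
  move : List (Set X × Set X) → Set X → Set X
  move_nonempty : ∀ h A, A.Nonempty → (move h A).Nonempty
  move_relOpen : ∀ h A, A.Nonempty → ∃ U : Set X, IsOpen U ∧ move h A = A ∩ U

/-- `A 0 ⊇ B 0 ⊇ A 1 ⊇ B 1 ⊇ …` is a play of the determination game in which `Σ` obeys the rules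
and `Ω` follows the strategy `σ`. -/
def DeterminationStrategy.IsPlay {X : Type*} [TopologicalSpace X]
    (σ : DeterminationStrategy X) (A B : ℕ → Set X) : Prop :=
  (∀ n, (A n).Nonempty) ∧ (∀ n, A (n + 1) ⊆ B n) ∧
    ∀ n, B n = σ.move ((List.range n).map fun i => (A i, B i)) (A n)

/-- The winning condition of `Ω`: the set `K = ⋂ₙ closure (A n)` is compact, and it is empty or
each of its neighborhoods contains all but finitely many of the sets `A n`. -/
def DeterminationWin {X : Type*} [TopologicalSpace X] (A : ℕ → Set X) : Prop :=
  IsCompact (⋂ n, closure (A n)) ∧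
    ((⋂ n, closure (A n)) = ∅ ∨ ∀ U ∈ 𝓝ˢ (⋂ n, closure (A n)), ∀ᶠ n in atTop, A n ⊆ U)

/-- `Ω` has a winning strategy in the determination game on `X`. -/
def IsGameDetermined (X : Type*) [TopologicalSpace X] : Prop :=
  ∃ σ : DeterminationStrategy X, ∀ A B : ℕ → Set X, σ.IsPlay A B → DeterminationWin A

/-! ### The Choquet game -/

/-- A strategy of the player `α` in the Choquet game on `X`: the first move is `X`, and
given the list `(U₀, V₀), …, (Uₙ₋₁, Vₙ₋₁)` of the previous rounds, with `Vₙ₋₁` non-empty and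
open, `α` answers by a non-empty open subset `Uₙ` of `Vₙ₋₁`.
(Its values on lists that are not legal positions are never used.) -/
structure ChoquetStrategy (X : Type*) [TopologicalSpace X] where
  move : List (Set X × Set X) → Set X
  move_nil : move [] = univ
  move_nonempty : ∀ h U V, IsOpen V → V.Nonempty → (move (h ++ [(U, V)])).Nonempty
  move_isOpen : ∀ h U V, IsOpen V → V.Nonempty → IsOpen (move (h ++ [(U, V)]))
  move_subset : ∀ h U V, IsOpen V → V.Nonempty → move (h ++ [(U, V)]) ⊆ V

/-- `U 0 ⊇ V 0 ⊇ U 1 ⊇ V 1 ⊇ …` is a play of the Choquet game in which `β` obeys the rules and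
`α` follows the strategy `σ`. -/
def ChoquetStrategy.IsPlay {X : Type*} [TopologicalSpace X]
    (σ : ChoquetStrategy X) (U V : ℕ → Set X) : Prop :=
  (∀ n, IsOpen (V n) ∧ (V n).Nonempty ∧ V n ⊆ U n) ∧
    ∀ n, U n = σ.move ((List.range n).map fun i => (U i, V i))

/-- `α` has a winning strategy in the Choquet game on `X`. -/
def IsChoquet (X : Type*) [TopologicalSpace X] : Prop :=
  ∃ σ : ChoquetStrategy X, ∀ U V : ℕ → Set X, σ.IsPlay U V → (⋂ n, U n).Nonempty

/-! Let `Ω` answer open moves from a base, each with closure inside the previous reply. The replies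
form a tree of open sets (`openScheme`), and a non-empty intersection along a branch is compact,
with the branch as a neighborhood base. The branches with non-empty intersection form a metrizable
space, and their intersections define an usco map to `X`.

If the multi-valued branches were non-meagre below every node extending some node, those through
that node would form a Baire space on which this usco map is minimal, contradicting the Stegall
property (`exists_isMeagre`). So good nodes, with only a meagre set of multi-valued branches, occur
below every node. Gluing the associated dense open sets (`exists_isOpen_singleValued`) and running
through maximal disjoint families of nodes in the Baire space `X` yields a dense Gδ set whose points
each determine a branch with one-point intersection. The branch map then embeds this set in a
product of discrete spaces.

Fragmentability implies the Stegall property by a category argument. A dense Gδ subset of a Baire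
space is Baire. For a Choquet space a second tree, of positions of the Choquet game, is built with
traces on the Gδ set of shrinking diameter. As `α` wins along every branch, the branch map has
closed range, which gives complete metrizability. -/

/-! ### Minimal usco maps -/

theorem isMinimalUsco_of_forall_exists_subset {Z X : Type*} [TopologicalSpace Z]
    [TopologicalSpace X] [T2Space X] {Φ : Z → Set X} (hΦ : IsUsco Φ)
    (h : ∀ W : Set Z, IsOpen W → ∀ V : Set X, IsOpen V → (∃ z ∈ W, (Φ z ∩ V).Nonempty) →
      ∃ W' ⊆ W, IsOpen W' ∧ W'.Nonempty ∧ ∀ z ∈ W', Φ z ⊆ V) : IsMinimalUsco Φ := by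
  refine ⟨hΦ, fun Ψ hΨ hsub => funext fun z => (Subset.antisymm ?_ (hsub z))⟩
  intro x hx
  by_contra hxΨ
  rw [isUsco_iff] at hΨ
  obtain ⟨U, V, hU, hV, hΨU, hxV, hUV⟩ :=
    SeparatedNhds.of_isCompact_isCompact (hΨ.1 z).2 isCompact_singleton
      (disjoint_singleton_right.2 hxΨ)
  obtain ⟨W', hW', -, ⟨z', hz'⟩, hW'V⟩ := h {z | Ψ z ⊆ U} (hΨ.2 U hU) V hV
    ⟨z, hΨU, x, hx, hxV rfl⟩
  obtain ⟨y, hy⟩ := (hΨ.1 z').1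
  exact hUV.le_bot ⟨hW' hz' hy, hW'V z' hz' (hsub z' hy)⟩

/-- Otherwise removing `V` from all values over `W` would leave a strictly smaller usco map. -/
theorem IsMinimalUsco.exists_subset {Z X : Type*} [TopologicalSpace Z]
    [TopologicalSpace X] {Φ : Z → Set X} (hΦ : IsMinimalUsco Φ)
    {W : Set Z} (hW : IsOpen W) {V : Set X} (hV : IsOpen V) {z : Z} (hz : z ∈ W)
    (hzV : (Φ z ∩ V).Nonempty) :
    ∃ W' ⊆ W, IsOpen W' ∧ W'.Nonempty ∧ ∀ z ∈ W', Φ z ⊆ V := by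
  classical
  by_contra! H
  have hU := (isUsco_iff Φ).1 hΦ.1
  have hnot : ∀ w ∈ W, ¬ Φ w ⊆ V := fun w hw hwV => by
    obtain ⟨w', hw', hn⟩ := H (W ∩ {z | Φ z ⊆ V}) inter_subset_left (hW.inter (hU.2 V hV))
      ⟨w, hw, hwV⟩
    exact hn hw'.2
  have key := hΦ.2 (fun w => if w ∈ W then Φ w \ V else Φ w) ?_ ?_
  · have := congrFun key z
    simp only [hz, if_true] at this
    obtain ⟨x, hx, hxV⟩ := hzV
    exact (this ▸ hx : x ∈ Φ z \ V).2 hxV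
  · rw [isUsco_iff]
    refine ⟨fun w => ?_, fun U hUo => ?_⟩
    · by_cases hw : w ∈ W
      · simp only [hw, if_true]
        exact ⟨nonempty_of_not_subset (hnot w hw), (hU.1 w).2.diff hV⟩
      · simpa only [hw, if_false] using hU.1 w
    -- Over `W` the condition `Φ w \ V ⊆ U` means `Φ w ⊆ V ∪ U`, which is weaker than `Φ w ⊆ U`.
    · convert (hU.2 U hUo).union (hW.inter (hU.2 (V ∪ U) (hV.union hUo))) using 1
      ext w
      by_cases hw : w ∈ W
      · simp only [hw, if_true, mem_ofPred_eq, mem_union, mem_inter_iff, true_and,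
          sdiff_subset_iff]
        exact ⟨Or.inr, fun h => h.elim (fun h => h.trans subset_union_right) id⟩
      · simp [hw]
  · intro w
    by_cases hw : w ∈ W
    · simp only [hw, if_true]
      exact sdiff_subset
    · simp [hw]

/-- Minimal usco maps from Baire spaces to fragmentable spaces have single-valued points. -/
theorem IsFragmentable.exists_eq_singleton {Z X : Type*} [TopologicalSpace Z] [BaireSpace Z]
    [Nonempty Z] [TopologicalSpace X] (hX : IsFragmentable X) {Φ : Z → Set X}
    (hΦ : IsMinimalUsco Φ) : ∃ (z : Z) (x : X), Φ z = {x} := by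
  obtain ⟨m, hm⟩ := hX
  let O : ℕ → Set Z := fun n => ⋃₀ {W | IsOpen W ∧ Metric.ediam (⋃ z ∈ W, Φ z) < ((n : ENNReal) + 1)⁻¹}
  have hO : ∀ n, IsOpen (O n) := fun n => isOpen_sUnion fun W hW => hW.1
  have hd : ∀ n, Dense (O n) := fun n => by
    rw [dense_iff_inter_open]
    rintro W hW ⟨z, hz⟩
    obtain ⟨x, hx⟩ := (hΦ.1.1 z).1
    -- Fragment the union of all values over `W`; minimality then pushes every value over a smaller
    -- open set into the small piece.
    obtain ⟨V, hV, ⟨y, hyA, hyV⟩, hdiam⟩ := hm ((n : ENNReal) + 1)⁻¹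
      (ENNReal.inv_pos.2 (by finiteness)) (⋃ z ∈ W, Φ z) ⟨x, mem_biUnion hz hx⟩
    obtain ⟨w, hw, hyw⟩ := mem_iUnion₂.1 hyA
    obtain ⟨W', hW'W, hW'o, ⟨w', hw'⟩, hW'V⟩ := hΦ.exists_subset hW hV hw ⟨y, hyw, hyV⟩
    refine ⟨w', hW'W hw', mem_sUnion.2 ⟨W', ⟨hW'o, lt_of_le_of_lt (Metric.ediam_mono ?_) hdiam⟩, hw'⟩⟩
    exact iUnion₂_subset fun v hv => subset_inter (subset_biUnion_of_mem (hW'W hv)) (hW'V v hv)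
  obtain ⟨z, hz⟩ := (dense_iInter_of_isOpen_nat hO hd).nonempty
  obtain ⟨x, hx⟩ := (hΦ.1.1 z).1
  refine ⟨z, x, Subset.antisymm (fun y hy => ?_) (singleton_subset_iff.2 hx)⟩
  have h0 : edist y x ≤ 0 := by
    refine le_of_forall_gt fun ε hε => ?_
    obtain ⟨n, hn⟩ := ENNReal.exists_inv_nat_lt hε.ne'
    obtain ⟨W, ⟨-, hW⟩, hzW⟩ := mem_sUnion.1 (mem_iInter.1 hz n)
    calc edist y x ≤ Metric.ediam (⋃ z ∈ W, Φ z) :=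
          Metric.edist_le_ediam_of_mem (mem_biUnion hzW hy) (mem_biUnion hzW hx)
      _ < ((n : ENNReal) + 1)⁻¹ := hW
      _ ≤ (n : ENNReal)⁻¹ := ENNReal.inv_le_inv.2 le_self_add
      _ < ε := hn
  exact edist_le_zero.1 h0

/-! ### Disjoint refinements and branch maps -/

section Tree

variable {X P : Type*} [TopologicalSpace X]

/-- Maximal disjoint families. -/
theorem exists_maximal_pairwiseDisjoint (o : P → Set X) (Q : P → Prop) (D : Set X)
    (hD : ∀ V : Set X, IsOpen V → (V ∩ D).Nonempty →
      ∃ q, Q q ∧ (o q).Nonempty ∧ o q ⊆ V) :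
    ∃ 𝒱 : Set P, (∀ q ∈ 𝒱, Q q) ∧ 𝒱.PairwiseDisjoint o ∧ D ⊆ closure (⋃ q ∈ 𝒱, o q) := by
  obtain ⟨𝒱, h𝒱⟩ := zorn_subset {𝒱 : Set P | (∀ q ∈ 𝒱, Q q) ∧ 𝒱.PairwiseDisjoint o} (by
    intro c hc hchain
    refine ⟨⋃₀ c, ⟨?_, ?_⟩, fun s hs => subset_sUnion_of_mem hs⟩
    · rintro q ⟨s, hs, hq⟩
      exact (hc hs).1 q hq
    · exact (pairwiseDisjoint_sUnion hchain.directedOn).2 fun s hs => (hc hs).2)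
  refine ⟨𝒱, h𝒱.prop.1, h𝒱.prop.2, ?_⟩
  intro x hx
  by_contra hcl
  obtain ⟨q, hq, ⟨y, hy⟩, hsub⟩ := hD _ isClosed_closure.isOpen_compl ⟨x, hcl, hx⟩
  have hmem : q ∈ 𝒱 := by
    refine h𝒱.le_of_ge (y := insert q 𝒱) ⟨?_, ?_⟩ (subset_insert _ _) (mem_insert _ _)
    · rintro p (rfl | hp)
      exacts [hq, h𝒱.prop.1 p hp]
    · refine h𝒱.prop.2.insert fun p hp _ => ?_
      refine disjoint_left.2 fun w hw hwp => hsub hw (subset_closure (mem_biUnion hp hwp))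
  exact hsub hy (subset_closure (mem_biUnion hmem hy))

/-- A system of disjoint families of open sets, each refining the previous one along `R`. -/
theorem exists_disjoint_refinements (o : P → Set X) (L : ℕ → P → Prop) (R : ℕ → P → P → Prop)
    (root : P) (hroot : L 0 root) (oroot : o root = univ)
    (hR : ∀ n p, L n p → ∀ V : Set X, IsOpen V → (V ∩ o p).Nonempty →
      ∃ q, L (n + 1) q ∧ R n p q ∧ (o q).Nonempty ∧ o q ⊆ V ∩ o p) :
    ∃ 𝒱 : ℕ → Set P, 𝒱 0 = {root} ∧ (∀ n, ∀ p ∈ 𝒱 n, L n p) ∧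
      (∀ n, (𝒱 n).PairwiseDisjoint o) ∧
      (∀ n, ∀ q ∈ 𝒱 (n + 1), ∃ p ∈ 𝒱 n, R n p q ∧ o q ⊆ o p) ∧
      ∀ n, Dense (⋃ p ∈ 𝒱 n, o p) := by
  have step : ∀ n, ∀ 𝒱 : {𝒱 : Set P // ∀ p ∈ 𝒱, L n p}, ∃ 𝒲 : {𝒱 : Set P // ∀ p ∈ 𝒱, L (n + 1) p},
      (∀ q ∈ 𝒲.1, ∃ p ∈ 𝒱.1, R n p q ∧ o q ⊆ o p) ∧ 𝒲.1.PairwiseDisjoint o ∧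
      (⋃ p ∈ 𝒱.1, o p) ⊆ closure (⋃ q ∈ 𝒲.1, o q) := by
    intro n 𝒱
    obtain ⟨𝒲, h1, h2, h3⟩ := exists_maximal_pairwiseDisjoint o
      (fun q => L (n + 1) q ∧ ∃ p ∈ 𝒱.1, R n p q ∧ o q ⊆ o p) (⋃ p ∈ 𝒱.1, o p) (by
        rintro V hV ⟨x, hxV, hx⟩
        obtain ⟨p, hp, hxp⟩ := mem_iUnion₂.1 hx
        obtain ⟨q, hLq, hRq, hne, hsub⟩ := hR n p (𝒱.2 p hp) V hV ⟨x, hxV, hxp⟩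
        exact ⟨q, ⟨hLq, p, hp, hRq, hsub.trans inter_subset_right⟩, hne,
          hsub.trans inter_subset_left⟩)
    exact ⟨⟨𝒲, fun q hq => (h1 q hq).1⟩, fun q hq => (h1 q hq).2, h2, h3⟩
  choose f hf using step
  let 𝒱 : ∀ n, {𝒱 : Set P // ∀ p ∈ 𝒱, L n p} := fun n =>
    Nat.rec ⟨{root}, fun p hp => by rw [mem_singleton_iff.1 hp]; exact hroot⟩ f n
  refine ⟨fun n => (𝒱 n).1, rfl, fun n => (𝒱 n).2, fun n => ?_, fun n => (hf n (𝒱 n)).1,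
    fun n => ?_⟩
  · cases n with
    | zero => exact pairwiseDisjoint_singleton _ _
    | succ n => exact (hf n (𝒱 n)).2.1
  · induction n with
    | zero =>
      have : (⋃ p ∈ (𝒱 0).1, o p) = univ := by simp [𝒱, oroot]
      exact this ▸ dense_univ
    | succ n ih =>
      exact dense_closure.1 (ih.mono (hf n (𝒱 n)).2.2)

/-- In a Baire space, disjoint refinements single out a dense `Gδ` set of points,
each of which determines a branch. -/
theorem exists_dense_isGδ_branches [BaireSpace X] (o : P → Set X) (L : ℕ → P → Prop)
    (R : ℕ → P → P → Prop) (ho : ∀ n p, L n p → IsOpen (o p))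
    (root : P) (hroot : L 0 root) (oroot : o root = univ)
    (hR : ∀ n p, L n p → ∀ V : Set X, IsOpen V → (V ∩ o p).Nonempty →
      ∃ q, L (n + 1) q ∧ R n p q ∧ (o q).Nonempty ∧ o q ⊆ V ∩ o p) :
    ∃ (G : Set X) (𝒱 : ℕ → Set P) (b : G → ℕ → P), Dense G ∧ IsGδ G ∧
      𝒱 0 = {root} ∧ (∀ n, ∀ p ∈ 𝒱 n, L n p) ∧
      (∀ x n, b x n ∈ 𝒱 n ∧ (x : X) ∈ o (b x n) ∧ R n (b x n) (b x (n + 1))) ∧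
      (∀ (x : G) (n), ∀ p ∈ 𝒱 n, (x : X) ∈ o p → p = b x n) ∧
      ∀ x : X, (∀ n, ∃ p ∈ 𝒱 n, x ∈ o p) → x ∈ G := by
  obtain ⟨𝒱, h0, hL, hdisj, href, hdense⟩ := exists_disjoint_refinements o L R root hroot oroot hR
  have hopen : ∀ n, IsOpen (⋃ p ∈ 𝒱 n, o p) := fun n =>
    isOpen_biUnion fun p hp => ho n p (hL n p hp)
  have hmem : ∀ x : ↥(⋂ n, ⋃ p ∈ 𝒱 n, o p), ∀ n, ∃ p ∈ 𝒱 n, (x : X) ∈ o p := fun x n => by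
    simpa using mem_iInter.1 x.2 n
  choose b hb𝒱 hbo using hmem
  have huniq : ∀ (x : ↥(⋂ n, ⋃ p ∈ 𝒱 n, o p)) (n), ∀ p ∈ 𝒱 n, (x : X) ∈ o p → p = b x n := fun x n p hp hxp => by
    by_contra hne
    exact (hdisj n hp (hb𝒱 x n) hne).le_bot ⟨hxp, hbo x n⟩
  refine ⟨⋂ n, ⋃ p ∈ 𝒱 n, o p, 𝒱, b, dense_iInter_of_isOpen_nat hopen hdense,
    .iInter_of_isOpen hopen, h0, hL, fun x n => ⟨hb𝒱 x n, hbo x n, ?_⟩, huniq, fun x hx => ?_⟩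
  -- The parent of the node at level `n + 1` also contains `x`, so by disjointness it is the node at
  -- level `n`.
  · obtain ⟨p, hp, hRp, hsub⟩ := href n _ (hb𝒱 x (n + 1))
    rwa [← huniq x n p hp (hsub (hbo x (n + 1)))]
  · exact mem_iInter.2 fun n => by simpa using hx n

/-- If the open sets along each branch form a neighborhood base in `G`, then the branch map
is an embedding into a product of discrete spaces. -/
theorem isEmbedding_branch [T0Space X] [TopologicalSpace P] [DiscreteTopology P] {o : P → Set X}
    {G : Set X} {b : G → ℕ → P}
    (ho : ∀ x n, IsOpen (o (b x n))) (hb : ∀ x n, (x : X) ∈ o (b x n))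
    (huniq : ∀ (x y : G) (n), (y : X) ∈ o (b x n) → b x n = b y n)
    (hbase : ∀ x : G, ∀ U : Set X, IsOpen U → (x : X) ∈ U → ∃ n, o (b x n) ∩ G ⊆ U) :
    IsEmbedding b := by
  have hloc : ∀ x n, {y : G | b y n = b x n} = Subtype.val ⁻¹' o (b x n) := fun x n => by
    ext y
    exact ⟨fun h => by rw [mem_preimage, ← h]; exact hb y n, fun h => (huniq x y n h).symm⟩
  refine IsInducing.isEmbedding (isInducing_iff_nhds.2 fun x => le_antisymm ?_ ?_)
  · refine Filter.map_le_iff_le_comap.1 (continuous_pi fun n => ?_).continuousAt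
    refine continuous_discrete_rng.2 fun p => ?_
    refine isOpen_iff_mem_nhds.2 fun y hy => ?_
    have : (fun x => b x n) ⁻¹' {p} = Subtype.val ⁻¹' o (b y n) := by
      rw [← hloc]
      ext w
      simp [← show b y n = p from hy]
    rw [this]
    exact ((ho y n).preimage continuous_subtype_val).mem_nhds (hb y n)
  · intro s hs
    obtain ⟨t, ht, hts⟩ := mem_nhds_induced _ _ _ |>.1 hs
    obtain ⟨U, hUt, hU, hxU⟩ := mem_nhds_iff.1 ht
    obtain ⟨n, hn⟩ := hbase x U hU hxU
    refine mem_comap.2 ⟨{c | c n = b x n}, ?_, fun y hy => hts (hUt (hn ⟨?_, y.2⟩))⟩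
    · exact ((isOpen_discrete ({b x n} : Set P)).preimage
        (continuous_apply (A := fun _ : ℕ => P) n)).mem_nhds rfl
    · exact (hloc x n).subset hy

end Tree

/-! ### Initial segments of sequences -/

/-- The list of the first `n` terms of a sequence. -/
def initSeg {α : Type*} (z : ℕ → α) (n : ℕ) : List α := (List.range n).map z

section initSeg

variable {α : Type*}

theorem initSeg_succ (z : ℕ → α) (n : ℕ) : initSeg z (n + 1) = initSeg z n ++ [z n] := by
  simp [initSeg, List.range_succ]

@[simp] theorem length_initSeg (z : ℕ → α) (n : ℕ) : (initSeg z n).length = n := by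
  simp [initSeg]

theorem initSeg_prefix (z : ℕ → α) {m n : ℕ} (h : m ≤ n) : initSeg z m <+: initSeg z n := by
  induction n, h using Nat.le_induction with
  | base => exact List.prefix_rfl
  | succ n _ ih => exact ih.trans (initSeg_succ z n ▸ List.prefix_append _ _)

theorem initSeg_congr {z w : ℕ → α} {m n : ℕ} (h : initSeg z n = initSeg w n) (hm : m ≤ n) :
    initSeg z m = initSeg w m := by
  have h1 := initSeg_prefix z hm
  have h2 := initSeg_prefix w hm
  rw [← h] at h2
  exact (List.prefix_of_prefix_length_le h1 h2 (by simp)).eq_of_length (by simp)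

theorem initSeg_eq_iff {z w : ℕ → α} {n : ℕ} :
    initSeg z n = initSeg w n ↔ ∀ i < n, z i = w i := by
  simp [initSeg]

theorem initSeg_of_prefix {z : ℕ → α} {p q : List α} (hpq : p <+: q)
    (hq : initSeg z q.length = q) : initSeg z p.length = p := by
  have h := initSeg_prefix z hpq.length_le
  rw [hq] at h
  exact (List.prefix_of_prefix_length_le h hpq (by simp)).eq_of_length (by simp)

/-- An increasing chain of longer and longer lists is the chain of initial segments
of a sequence. -/
theorem exists_initSeg_eq {p : ℕ → List α} (hp : ∀ n, p n <+: p (n + 1))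
    (hl : ∀ n, (p n).length < (p (n + 1)).length) :
    ∃ z : ℕ → α, ∀ n, initSeg z (p n).length = p n := by
  have hmono : ∀ {m n}, m ≤ n → p m <+: p n := fun {m n} h => by
    induction n, h using Nat.le_induction with
    | base => exact List.prefix_rfl
    | succ n _ ih => exact ih.trans (hp n)
  have hlen : ∀ n, n < (p (n + 1)).length := fun n => by
    induction n with
    | zero => exact (Nat.zero_le _).trans_lt (hl 0)
    | succ n ih => have := hl (n + 1); omega
  refine ⟨fun k => (p (k + 1))[k]'(hlen k), fun n => List.ext_getElem (by simp) fun i h1 h2 => ?_⟩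
  simp only [initSeg, List.getElem_map, List.getElem_range]
  rcases le_total (i + 1) n with h | h
  · exact List.IsPrefix.getElem (hmono h) (hlen i)
  · exact (List.IsPrefix.getElem (hmono h) h2).symm

theorem isOpen_setOf_initSeg_eq [TopologicalSpace α] [DiscreteTopology α] (n : ℕ) (p : List α) :
    IsOpen {z : ℕ → α | initSeg z n = p} := by
  refine isOpen_iff_mem_nhds.2 fun z hz => ?_
  have : (⋂ i ∈ Finset.range n, {w : ℕ → α | w i = z i}) ∈ 𝓝 z := by
    refine (Filter.biInter_finset_mem _).2 fun i _ => ?_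
    exact ((isOpen_discrete ({z i} : Set α)).preimage
        (continuous_apply (A := fun _ : ℕ => α) i)).mem_nhds rfl
  filter_upwards [this] with w hw
  rw [← show initSeg z n = p from hz, initSeg_eq_iff]
  exact fun i hi => mem_iInter₂.1 hw i (Finset.mem_range.2 hi)

theorem exists_initSeg_subset [TopologicalSpace α] [DiscreteTopology α] {U : Set (ℕ → α)}
    (hU : IsOpen U) {z : ℕ → α} (hz : z ∈ U) :
    ∃ n, ∀ w, initSeg w n = initSeg z n → w ∈ U := by
  obtain ⟨I, u, hu, hsub⟩ := isOpen_pi_iff.1 hU z hz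
  obtain ⟨n, hn⟩ := I.exists_nat_subset_range
  refine ⟨n, fun w hw => hsub fun i hi => ?_⟩
  rw [initSeg_eq_iff.1 hw i (Finset.mem_range.1 (hn hi))]
  exact (hu i hi).2

end initSeg

/-! ### Open schemes and their spaces of branches -/

/-- A tree of open sets indexed by finite sequences, such that the intersection along each branch
is either empty or compact with the members of the branch as a neighborhood base. -/
structure OpenScheme (X : Type*) [TopologicalSpace X] (α : Type u) where
  succ : List α → α → Prop
  set : List α → Set X
  isOpen_set : ∀ p, IsOpen (set p)
  set_nil : set [] = univ
  closure_subset : ∀ p a, succ p a → closure (set (p ++ [a])) ⊆ set p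
  exists_subset : ∀ p, ∀ V : Set X, IsOpen V → (V ∩ set p).Nonempty →
    ∃ a, succ p a ∧ (set (p ++ [a])).Nonempty ∧ set (p ++ [a]) ⊆ V
  isCompact_iInter : ∀ z : ℕ → α, (∀ n, succ (initSeg z n) (z n)) →
    (⋂ n, set (initSeg z n)).Nonempty → IsCompact (⋂ n, set (initSeg z n))
  exists_set_subset : ∀ z : ℕ → α, (∀ n, succ (initSeg z n) (z n)) →
    (⋂ n, set (initSeg z n)).Nonempty → ∀ U : Set X, IsOpen U → (⋂ n, set (initSeg z n)) ⊆ U →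
    ∃ n, set (initSeg z n) ⊆ U

namespace OpenScheme

variable {X : Type*} [TopologicalSpace X] {α : Type u} (T : OpenScheme X α)

/-- The intersection along a branch. -/
def value (z : ℕ → α) : Set X := ⋂ n, T.set (initSeg z n)

/-- The branches with non-empty intersection. -/
def branches : Set (ℕ → α) := {z | (∀ n, T.succ (initSeg z n) (z n)) ∧ (T.value z).Nonempty}

/-- The nodes of the tree. -/
def Legal (p : List α) : Prop := ∀ q a, q ++ [a] <+: p → T.succ q a

variable {T}

theorem legal_nil : T.Legal [] := fun q a h => by simp at h

theorem Legal.append {p : List α} {a : α} (hp : T.Legal p) (ha : T.succ p a) :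
    T.Legal (p ++ [a]) := fun q b h => by
  rcases List.prefix_concat_iff.1 h with h | h
  · obtain ⟨rfl, h⟩ := List.append_inj' h rfl
    obtain rfl : b = a := by simpa using h
    exact ha
  · exact hp q b h

theorem legal_initSeg {z : ℕ → α} (hz : ∀ n, T.succ (initSeg z n) (z n)) (n : ℕ) :
    T.Legal (initSeg z n) := by
  induction n with
  | zero => exact legal_nil
  | succ n ih => exact initSeg_succ z n ▸ ih.append (hz n)

theorem set_initSeg_subset {z : ℕ → α} (hz : ∀ n, T.succ (initSeg z n) (z n)) {m n : ℕ}
    (h : m ≤ n) : T.set (initSeg z n) ⊆ T.set (initSeg z m) := by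
  induction n, h using Nat.le_induction with
  | base => exact Subset.rfl
  | succ n _ ih =>
    exact (initSeg_succ z n ▸ subset_closure.trans (T.closure_subset _ _ (hz n))).trans ih

theorem set_subset_of_prefix {p q : List α} (hq : T.Legal q) (hpq : p <+: q) :
    T.set q ⊆ T.set p := by
  induction q using List.reverseRecOn with
  | nil => rw [List.prefix_nil.1 hpq]
  | append_singleton q a ih =>
    rcases List.prefix_concat_iff.1 hpq with h | h
    · rw [h]
    · exact (subset_closure.trans (T.closure_subset _ _ (hq q a List.prefix_rfl))).trans
        (ih (fun r b hr => hq r b (hr.trans (List.prefix_append _ _))) h)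

theorem value_subset (z : ℕ → α) (n : ℕ) : T.value z ⊆ T.set (initSeg z n) := iInter_subset _ n

variable (T) in
/-- The branches through a node. -/
def cylinder (p : List α) : Set T.branches := {z | initSeg z.1 p.length = p}

theorem mem_cylinder_initSeg (z : T.branches) (n : ℕ) : z ∈ T.cylinder (initSeg z.1 n) := by
  simp [cylinder]

variable [TopologicalSpace α] [DiscreteTopology α]

theorem isUsco_value (F : Set T.branches) : IsUsco fun z : F => T.value z.1.1 := by
  refine (isUsco_iff _).2 ⟨fun z => ⟨z.1.2.2, T.isCompact_iInter _ z.1.2.1 z.1.2.2⟩,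
    fun U hU => isOpen_iff_mem_nhds.2 fun z hz => ?_⟩
  obtain ⟨n, hn⟩ := T.exists_set_subset _ z.1.2.1 z.1.2.2 U hU hz
  have hc : Continuous fun w : F => w.1.1 := continuous_subtype_val.comp continuous_subtype_val
  filter_upwards [((isOpen_setOf_initSeg_eq n (initSeg z.1.1 n)).preimage hc).mem_nhds rfl]
    with w hw
  have hw' : initSeg w.1.1 n = initSeg z.1.1 n := hw
  exact (value_subset w.1.1 n).trans (hw' ▸ hn)

theorem isOpen_cylinder (p : List α) : IsOpen (T.cylinder p) :=
  (isOpen_setOf_initSeg_eq _ p).preimage continuous_subtype_val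

theorem exists_cylinder_subset {U : Set T.branches} (hU : IsOpen U) {z : T.branches}
    (hz : z ∈ U) (k : ℕ) : ∃ n ≥ k, T.cylinder (initSeg z.1 n) ⊆ U := by
  obtain ⟨V, hV, rfl⟩ := isOpen_induced_iff.1 hU
  obtain ⟨n, hn⟩ := exists_initSeg_subset hV hz
  refine ⟨max n k, le_max_right _ _, fun w hw => hn _ (initSeg_congr ?_ (le_max_left n k))⟩
  simpa [cylinder] using hw

variable (T) in
/-- The branches with a one-point intersection. -/
def singleValued : Set T.branches := {z | ∃ x, T.value z.1 = {x}}

theorem topDensity_le {X : Type u} [TopologicalSpace X] {T : OpenScheme X α} (F : Set T.branches) :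
    topDensity F ≤ Cardinal.mk (List α) := by
  classical
  rcases isEmpty_or_nonempty F with hF | hF
  · exact (csInf_le' (mem_ofPred.2 ⟨∅, fun x => (hF.false x).elim, rfl⟩)).trans (by simp)
  -- One point of `F` from each cylinder that meets `F`, and an arbitrary one for the others.
  let f : List α → F := fun p =>
    if h : ∃ z : F, z.1 ∈ T.cylinder p then h.choose else Classical.arbitrary F
  refine (csInf_le' (mem_ofPred.2 ⟨range f, ?_, rfl⟩)).trans Cardinal.mk_range_le
  refine dense_iff_inter_open.2 ?_
  rintro U hU ⟨z, hz⟩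
  obtain ⟨V, hV, rfl⟩ := isOpen_induced_iff.1 hU
  obtain ⟨n, -, hn⟩ := exists_cylinder_subset hV hz 0
  have h : ∃ w : F, w.1 ∈ T.cylinder (initSeg z.1.1 n) := ⟨z, mem_cylinder_initSeg _ _⟩
  refine ⟨f (initSeg z.1.1 n), hn ?_, mem_range_self _⟩
  simp only [f, dif_pos h]
  exact h.choose_spec

/-- If this fails, the multi-valued branches through `p` meet every cylinder of a non-empty node
below `p` in a non-meagre set. They therefore form a Baire space, and every such node has one of
them passing through it, which makes the value map minimal. -/
theorem exists_isMeagre {X : Type u} [TopologicalSpace X] [T2Space X] {T : OpenScheme X α}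
    {κ : Cardinal.{u}} (hκ : Cardinal.mk (List α) ≤ κ)
    (hX : IsStegallFor (BaireMetrizableOfDensityLE κ) X) {p : List α} (hp : T.Legal p)
    (hne : (T.set p).Nonempty) :
    ∃ q, p <+: q ∧ T.Legal q ∧ (T.set q).Nonempty ∧
      IsMeagre (T.cylinder q \ T.singleValued) := by
  by_contra! H
  let F : Set T.branches := T.cylinder p \ T.singleValued
  have hcyl : ∀ z : F, ∀ n ≥ p.length, p <+: initSeg z.1.1 n := fun z n hn => by
    have := initSeg_prefix z.1.1 hn
    rwa [show initSeg z.1.1 p.length = p from z.2.1] at this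
  have hsub : ∀ {q}, p <+: q → T.cylinder q ⊆ T.cylinder p := fun hpq z hz =>
    initSeg_of_prefix hpq hz
  have hmem : ∀ q, p <+: q → T.Legal q → (T.set q).Nonempty →
      ∃ z : F, z.1 ∈ T.cylinder q := fun q hpq hq hqne => by
    obtain ⟨z, hz, hzE⟩ := nonempty_of_not_isMeagre (H q hpq hq hqne)
    exact ⟨⟨z, hsub hpq hz, hzE⟩, hz⟩
  have hnode : ∀ U : Set F, IsOpen U → ∀ z ∈ U, ∃ n ≥ p.length,
      (∀ w : F, w.1 ∈ T.cylinder (initSeg z.1.1 n) → w ∈ U) := fun U hU z hz => by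
    obtain ⟨V, hV, rfl⟩ := isOpen_induced_iff.1 hU
    obtain ⟨n, hn, h⟩ := exists_cylinder_subset hV hz p.length
    exact ⟨n, hn, fun w hw => h hw⟩
  have hnonmeagre : ∀ U : Set F, IsOpen U → U.Nonempty → ¬ IsMeagre U := by
    rintro U hU ⟨z, hz⟩ hme
    obtain ⟨n, hn, h⟩ := hnode U hU z hz
    refine H _ (hcyl z n hn) (legal_initSeg z.1.2.1 n)
      (z.1.2.2.mono (value_subset _ n)) (hme.image_val.mono ?_)
    rintro w ⟨hw, hwE⟩
    exact ⟨⟨w, hsub (hcyl z n hn) hw, hwE⟩, h _ hw, rfl⟩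
  have hBaire : BaireSpace F := ⟨fun f hf hd => by
    refine dense_iff_inter_open.2 fun U hU hUne => ?_
    by_contra hemp
    refine hnonmeagre U hU hUne (IsMeagre.mono (t := U) ?_ (s := (⋂ n, f n)ᶜ) ?_)
    · intro z hz hzf
      exact hemp ⟨z, hz, hzf⟩
    · rw [IsMeagre, compl_compl]
      exact countable_iInter_mem.2 fun n => residual_of_dense_open (hf n) (hd n)⟩
  obtain ⟨z0, -⟩ := hmem p List.prefix_rfl hp hne
  obtain ⟨z, x, hzx⟩ := hX F ⟨hBaire, inferInstance, (topDensity_le F).trans hκ⟩ ⟨z0⟩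
    (fun z : F => T.value z.1.1) <| by
      refine isMinimalUsco_of_forall_exists_subset (isUsco_value F) ?_
      rintro W hW V hV ⟨z, hz, x, hxz, hxV⟩
      obtain ⟨n, hn, h⟩ := hnode W hW z hz
      -- Going to a child inside `V` forces the values of all branches through it into `V`.
      obtain ⟨a, ha, hane, haV⟩ := T.exists_subset (initSeg z.1.1 n) V hV
        ⟨x, hxV, value_subset _ n hxz⟩
      have hpre : initSeg z.1.1 n <+: initSeg z.1.1 n ++ [a] := List.prefix_append _ _
      refine ⟨{w | w.1 ∈ T.cylinder (initSeg z.1.1 n ++ [a])}, fun w hw => h w ?_,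
        (isOpen_cylinder _).preimage continuous_subtype_val, ?_, fun w hw => ?_⟩
      · exact initSeg_of_prefix hpre hw
      · exact hmem _ ((hcyl z n hn).trans hpre) ((legal_initSeg z.1.2.1 n).append ha) hane
      · refine Subset.trans ?_ haV
        rw [← show initSeg w.1.1 _ = _ from hw]
        exact value_subset _ _
  exact z.2.2 ⟨x, hzx⟩

/-- The first good nodes along branches have disjoint cylinders, so the dense open sets witnessing
meagreness can be chosen separately for each and glued. -/
theorem exists_isOpen_singleValued {X : Type u} [TopologicalSpace X] [T2Space X]
    {T : OpenScheme X α} {κ : Cardinal.{u}} (hκ : Cardinal.mk (List α) ≤ κ)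
    (hX : IsStegallFor (BaireMetrizableOfDensityLE κ) X) :
    ∃ O : ℕ → Set T.branches, (⋂ n, O n) ⊆ T.singleValued ∧
      ∀ n p, T.Legal p → (T.set p).Nonempty →
        ∃ q, p <+: q ∧ T.Legal q ∧ (T.set q).Nonempty ∧ T.cylinder q ⊆ O n := by
  classical
  let Good : List α → Prop := fun p => IsMeagre (T.cylinder p \ T.singleValued)
  have hex : ∀ p, ∃ U : ℕ → Set T.branches, (∀ n, IsOpen (U n)) ∧ (∀ n, Dense (U n)) ∧
      (Good p → (⋂ n, U n) ⊆ (T.cylinder p \ T.singleValued)ᶜ) := fun p => by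
    by_cases hp : Good p
    · obtain ⟨S, hSo, hSd, hSc, hS⟩ := mem_residual_iff.1 hp
      -- Adding `univ` makes the family non-empty, hence enumerable by a sequence.
      obtain ⟨U, hU⟩ := (hSc.insert univ).exists_eq_range (insert_nonempty _ _)
      have hmem : ∀ n, U n = univ ∨ U n ∈ S := fun n => by
        simpa using (hU ▸ mem_range_self n : U n ∈ insert univ S)
      refine ⟨U, fun n => ?_, fun n => ?_, fun _ => Subset.trans ?_ hS⟩
      · rcases hmem n with h | h
        exacts [h ▸ isOpen_univ, hSo _ h]
      · rcases hmem n with h | h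
        exacts [h ▸ dense_univ, hSd _ h]
      · intro z hz t ht
        obtain ⟨n, rfl⟩ : t ∈ range U := hU ▸ mem_insert_of_mem _ ht
        exact mem_iInter.1 hz n
    · exact ⟨fun _ => univ, fun _ => isOpen_univ, fun _ => dense_univ, fun h => (hp h).elim⟩
  choose U hUo hUd hU using hex
  refine ⟨fun k => {z | ∃ n, (Good (initSeg z.1 n) ∧ ∀ m < n, ¬ Good (initSeg z.1 m)) ∧
    z ∈ U (initSeg z.1 n) k}, ?_, ?_⟩
  · intro z hz
    obtain ⟨n, ⟨hn, hmin⟩, -⟩ := mem_iInter.1 hz 0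
    by_contra hE
    refine hU _ hn (mem_iInter.2 fun k => ?_) ⟨mem_cylinder_initSeg z n, hE⟩
    obtain ⟨m, ⟨hm, hmin'⟩, hzm⟩ := mem_iInter.1 hz k
    obtain rfl : m = n := le_antisymm (not_lt.1 fun h => hmin' n h hn)
      (not_lt.1 fun h => hmin m h hm)
    exact hzm
  · intro k p hp hne
    obtain ⟨q, hpq, hq, hqne, hgood⟩ := exists_isMeagre hκ hX hp hne
    by_cases hemp : (T.cylinder q).Nonempty
    · obtain ⟨z, hz⟩ := hemp
      have hG : ∃ n, Good (initSeg z.1 n) := ⟨q.length, by rwa [show initSeg z.1 _ = q from hz]⟩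
      obtain ⟨w, ⟨hwz, hwq⟩, hwU⟩ := (hUd (initSeg z.1 (Nat.find hG)) k).inter_open_nonempty _
        ((isOpen_cylinder (initSeg z.1 (Nat.find hG))).inter (isOpen_cylinder q))
        ⟨z, mem_cylinder_initSeg _ _, hz⟩
      -- At this length all branches of the cylinder pass through `q` and share the first good node
      -- of `z`.
      obtain ⟨m, hm, hsub⟩ := exists_cylinder_subset (hUo (initSeg z.1 (Nat.find hG)) k) hwU
        (max (Nat.find hG) q.length)
      have hqw : q <+: initSeg w.1 m := by
        rw [← show initSeg w.1 _ = q from hwq]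
        exact initSeg_prefix _ ((le_max_right _ _).trans hm)
      refine ⟨initSeg w.1 m, hpq.trans hqw, legal_initSeg w.2.1 m,
        w.2.2.mono (value_subset _ m), fun v hv => ?_⟩
      have hvw : initSeg v.1 m = initSeg w.1 m := by simpa [cylinder] using hv
      have hwz' : initSeg w.1 (Nat.find hG) = initSeg z.1 (Nat.find hG) := by
        simpa [cylinder] using hwz
      have hvz : ∀ i ≤ Nat.find hG, initSeg v.1 i = initSeg z.1 i := fun i hi =>
        (initSeg_congr hvw (hi.trans ((le_max_left _ _).trans hm))).trans
          (initSeg_congr hwz' hi)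
      refine ⟨Nat.find hG, ⟨?_, fun i hi => ?_⟩, ?_⟩
      · rw [hvz _ le_rfl]
        exact Nat.find_spec hG
      · rw [hvz i hi.le]
        exact Nat.find_min hG hi
      · rw [hvz _ le_rfl]
        exact hsub hv
    -- A node with non-empty set may carry no branch with non-empty intersection; the inclusion is
    -- then vacuous.
    · exact ⟨q, hpq, hq, hqne, fun z hz => (hemp ⟨z, hz⟩).elim⟩

/-- A Baire Stegall space with an open scheme has a dense metrizable `Gδ` subset. -/
theorem exists_dense_isGδ_metrizable {X : Type u} [TopologicalSpace X] [T2Space X] [BaireSpace X]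
    (T : OpenScheme X α) {κ : Cardinal.{u}} (hκ : Cardinal.mk (List α) ≤ κ)
    (hX : IsStegallFor (BaireMetrizableOfDensityLE κ) X) :
    ∃ S : Set X, Dense S ∧ IsGδ S ∧ TopologicalSpace.MetrizableSpace S := by
  obtain ⟨O, hOE, hO⟩ := exists_isOpen_singleValued (T := T) hκ hX
  obtain ⟨G, 𝒱, b, hGd, hGδ, -, -, hb, huniq, -⟩ := exists_dense_isGδ_branches T.set
    (fun _ p => T.Legal p)
    -- Strict growth in length makes the nodes at a point cohere into one infinite sequence, which
    -- lies in every `O n`.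
    (fun n p q => T.Legal q ∧ p <+: q ∧ p.length < q.length ∧ T.cylinder q ⊆ O n)
    (fun _ p _ => T.isOpen_set p) [] legal_nil T.set_nil (by
      intro n p hp V hV hne
      obtain ⟨a, ha, hane, haV⟩ := T.exists_subset p (V ∩ T.set p) (hV.inter (T.isOpen_set p))
        (by rwa [inter_assoc, inter_self])
      obtain ⟨q, hq, hql, hqne, hqO⟩ := hO n (p ++ [a]) (hp.append ha) hane
      have hlen := hq.length_le
      rw [List.length_append, List.length_singleton] at hlen
      exact ⟨q, hql, ⟨hql, (List.prefix_append _ _).trans hq, hlen, hqO⟩, hqne,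
        (set_subset_of_prefix hql hq).trans haV⟩)
  let _ : TopologicalSpace (List α) := ⊥
  have : DiscreteTopology (List α) := ⟨rfl⟩
  refine ⟨G, hGd, hGδ, (isEmbedding_branch (o := T.set) (b := b) (fun x n => T.isOpen_set _)
    (fun x n => (hb x n).2.1) (fun x y n h => huniq y n _ (hb x n).1 h)
    fun x U hU hxU => ?_).metrizableSpace⟩
  obtain ⟨z, hz⟩ := exists_initSeg_eq (fun n => (hb x n).2.2.2.1) (fun n => (hb x n).2.2.2.2.1)
  have hlen : ∀ n, n < (b x (n + 1)).length := fun n => by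
    induction n with
    | zero => exact (Nat.zero_le _).trans_lt (hb x 0).2.2.2.2.1
    | succ n ih => have := (hb x (n + 1)).2.2.2.2.1; omega
  have hzs : ∀ n, T.succ (initSeg z n) (z n) := fun n => by
    have h := (hb x n).2.2.1
    rw [← hz] at h
    refine h _ _ ?_
    rw [← initSeg_succ]
    exact initSeg_prefix z (hlen n)
  have hxz : (x : X) ∈ T.value z := mem_iInter.2 fun n => by
    have h := (hb x (n + 1)).2.1
    rw [← hz] at h
    exact set_initSeg_subset hzs (hlen n).le h
  have hzE : (⟨z, hzs, x, hxz⟩ : T.branches) ∈ T.singleValued :=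
    hOE (mem_iInter.2 fun n => (hb x n).2.2.2.2.2 (hz (n + 1)))
  obtain ⟨y, hy : T.value z = {y}⟩ := hzE
  obtain rfl : (x : X) = y := by simpa [hy] using hxz
  obtain ⟨n, hn⟩ := T.exists_set_subset z hzs ⟨x, hxz⟩ U hU
    (by rw [← value, hy]; exact singleton_subset_iff.2 hxU)
  refine ⟨n + 1, inter_subset_left.trans (Subset.trans ?_ hn)⟩
  rw [← hz (n + 1)]
  exact set_initSeg_subset hzs (hlen n).le

end OpenScheme

/-! ### The scheme of a winning strategy in the determination game -/

namespace DeterminationStrategy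

variable {X : Type*} [TopologicalSpace X] (σ : DeterminationStrategy X)

/-- The rounds of the play in which `Σ` plays the sets of the list. -/
def rounds (p : List (Set X)) : List (Set X × Set X) :=
  p.foldl (fun h A => h ++ [(A, σ.move h A)]) []

/-- The last move of `Ω` against the list of moves of `Σ`. -/
def reply (p : List (Set X)) : Set X := ((σ.rounds p).getLast?.map Prod.snd).getD univ

@[simp] theorem rounds_concat (p : List (Set X)) (A : Set X) :
    σ.rounds (p ++ [A]) = σ.rounds p ++ [(A, σ.move (σ.rounds p) A)] := by
  simp [rounds]

@[simp] theorem reply_concat (p : List (Set X)) (A : Set X) :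
    σ.reply (p ++ [A]) = σ.move (σ.rounds p) A := by
  simp [reply]

theorem move_subset (h : List (Set X × Set X)) {A : Set X} (hA : A.Nonempty) :
    σ.move h A ⊆ A := by
  obtain ⟨U, -, hU⟩ := σ.move_relOpen h A hA
  exact hU ▸ inter_subset_left

theorem isOpen_move (h : List (Set X × Set X)) {A : Set X} (hA : A.Nonempty) (ho : IsOpen A) :
    IsOpen (σ.move h A) := by
  obtain ⟨U, hU, hUA⟩ := σ.move_relOpen h A hA
  exact hUA ▸ ho.inter hU

theorem isOpen_reply {α : Type*} {f : α → Set X} (hf : ∀ a, (f a).Nonempty)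
    (ho : ∀ a, IsOpen (f a)) (p : List α) : IsOpen (σ.reply (p.map f)) := by
  induction p using List.reverseRecOn with
  | nil => exact isOpen_univ
  | append_singleton p a ih =>
    rw [List.map_append, List.map_singleton, reply_concat]
    exact σ.isOpen_move _ (hf a) (ho a)

theorem rounds_initSeg {α : Type*} (f : α → Set X) (z : ℕ → α) (n : ℕ) :
    σ.rounds ((initSeg z n).map f) = (List.range n).map fun i =>
      (f (z i), σ.move (σ.rounds ((initSeg z i).map f)) (f (z i))) := by
  induction n with
  | zero => rfl
  | succ n ih => rw [initSeg_succ, List.map_append, List.map_singleton, rounds_concat,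
      List.range_succ, List.map_append, ← ih, List.map_singleton]

variable {σ}

theorem isPlay_of_closure_subset {α : Type*} {f : α → Set X} (hf : ∀ a, (f a).Nonempty)
    {z : ℕ → α} (hz : ∀ n, closure (f (z n)) ⊆ σ.reply ((initSeg z n).map f)) :
    σ.IsPlay (fun n => f (z n)) (fun n => σ.move (σ.rounds ((initSeg z n).map f)) (f (z n))) := by
  refine ⟨fun n => hf _, fun n => ?_, fun n => ?_⟩
  · have := subset_closure.trans (hz (n + 1))
    rwa [initSeg_succ, List.map_append, List.map_singleton, reply_concat] at this
  · exact congrArg (σ.move · (f (z n))) (σ.rounds_initSeg f z n)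

/-- The two sequences interlace: each closed move lies in the preceding reply, and the next reply
lies in that move. -/
theorem iInter_reply_eq {α : Type*} {f : α → Set X} (hf : ∀ a, (f a).Nonempty)
    {z : ℕ → α} (hz : ∀ n, closure (f (z n)) ⊆ σ.reply ((initSeg z n).map f)) :
    ⋂ n, σ.reply ((initSeg z n).map f) = ⋂ n, closure (f (z n)) := by
  refine Subset.antisymm (fun x hx => mem_iInter.2 fun n => subset_closure ?_)
    (iInter_mono hz)
  have := mem_iInter.1 hx (n + 1)
  rw [initSeg_succ, List.map_append, List.map_singleton, reply_concat] at this
  exact σ.move_subset _ (hf _) this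

variable (σ) in
/-- The scheme of the replies of a winning strategy to open moves from a base. -/
def openScheme [RegularSpace X] (hσ : ∀ A B : ℕ → Set X, σ.IsPlay A B → DeterminationWin A)
    {B : Set (Set X)} (hB : TopologicalSpace.IsTopologicalBasis B) :
    OpenScheme X {A // A ∈ B ∧ A.Nonempty} where
  succ p a := closure a.1 ⊆ σ.reply (p.map Subtype.val)
  set p := σ.reply (p.map Subtype.val)
  isOpen_set p := σ.isOpen_reply (fun a => a.2.2) (fun a => hB.isOpen a.2.1) p
  set_nil := rfl
  closure_subset p a h := by
    rw [List.map_append, List.map_singleton, reply_concat]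
    exact (closure_mono (σ.move_subset _ a.2.2)).trans h
  exists_subset p V hV := by
    rintro ⟨x, hxV, hxp⟩
    have hp : IsOpen (σ.reply (p.map Subtype.val)) :=
      σ.isOpen_reply (fun a => a.2.2) (fun a => hB.isOpen a.2.1) p
    obtain ⟨A, hA, hxA, hcl⟩ := hB.exists_closure_subset ((hV.inter hp).mem_nhds ⟨hxV, hxp⟩)
    refine ⟨⟨A, hA, x, hxA⟩, hcl.trans inter_subset_right, ?_, ?_⟩ <;>
      rw [List.map_append, List.map_singleton, reply_concat]
    · exact σ.move_nonempty _ _ ⟨x, hxA⟩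
    · exact (σ.move_subset _ ⟨x, hxA⟩).trans
        (subset_closure.trans (hcl.trans inter_subset_left))
  isCompact_iInter z hz hne := by
    rw [iInter_reply_eq (fun a => a.2.2) hz]
    exact (hσ _ _ (isPlay_of_closure_subset (fun a => a.2.2) hz)).1
  exists_set_subset z hz hne U hU hsub := by
    rw [iInter_reply_eq (fun a => a.2.2) hz] at hne hsub
    obtain ⟨n, hn⟩ := ((hσ _ _ (isPlay_of_closure_subset (fun a => a.2.2) hz)).2.resolve_left
      hne.ne_empty U (hU.mem_nhdsSet.2 hsub)).exists
    refine ⟨n + 1, ?_⟩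
    rw [initSeg_succ, List.map_append, List.map_singleton, reply_concat]
    exact (σ.move_subset _ (z n).2.2).trans hn

end DeterminationStrategy

theorem TopologicalSpace.IsTopologicalBasis.finite_of_finite {X : Type*} [TopologicalSpace X]
    [T0Space X] {B : Set (Set X)} (hB : IsTopologicalBasis B) (hfin : B.Finite) : Finite X := by
  have : Finite B := hfin
  refine Finite.of_injective (fun x : X => {b : B | x ∈ b.1}) fun x y hxy => ?_
  refine (hB.inseparable_iff.2 fun b hb => ?_).eq
  exact Set.ext_iff.1 hxy ⟨b, hb⟩

/-- A game determined Baire Stegall space has a dense metrizable `Gδ` subset. -/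
theorem IsGameDetermined.exists_dense_isGδ_metrizable {X : Type u} [TopologicalSpace X]
    [T3Space X] [BaireSpace X] (hX : IsGameDetermined X)
    (hS : IsStegallFor (BaireMetrizableOfDensityLE (topWeight X)) X) :
    ∃ S : Set X, Dense S ∧ IsGδ S ∧ TopologicalSpace.MetrizableSpace S := by
  obtain ⟨σ, hσ⟩ := hX
  obtain ⟨B, hB, hBw⟩ : ∃ B : Set (Set X), TopologicalSpace.IsTopologicalBasis B ∧
      Cardinal.mk B = topWeight X :=
    csInf_mem (s := {κ | ∃ B : Set (Set X), TopologicalSpace.IsTopologicalBasis B ∧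
      Cardinal.mk B = κ}) ⟨_, _, TopologicalSpace.isTopologicalBasis_opens, rfl⟩
  rcases B.finite_or_infinite with hfin | hinf
  -- Lists over a non-empty finite base are already infinite in number, so the density bound needs
  -- an infinite base; here `X` is finite and hence discrete.
  · have := hB.finite_of_finite hfin
    exact ⟨univ, dense_univ, .univ, inferInstance⟩
  · let _ : TopologicalSpace {A // A ∈ B ∧ A.Nonempty} := ⊥
    have : DiscreteTopology {A // A ∈ B ∧ A.Nonempty} := ⟨rfl⟩
    refine (σ.openScheme hσ hB).exists_dense_isGδ_metrizable ?_ hS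
    rw [← hBw]
    refine (Cardinal.mk_list_le_max _).trans (max_le ?_ ?_)
    · exact Cardinal.aleph0_le_mk_iff.2 hinf.to_subtype
    · exact Cardinal.mk_le_mk_of_subset (fun A hA => hA.1)

/-! ### The Choquet game and complete metrizability -/

namespace ChoquetStrategy

variable {X : Type*} [TopologicalSpace X] {σ : ChoquetStrategy X}

variable (σ) in
/-- The position `q` arises from `p` by one more round. -/
def IsNext (p q : List (Set X × Set X)) : Prop :=
  ∃ V : Set X, IsOpen V ∧ V.Nonempty ∧ V ⊆ σ.move p ∧ q = p ++ [(σ.move p, V)]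

theorem IsNext.isOpen_move {p q : List (Set X × Set X)} (h : σ.IsNext p q) :
    IsOpen (σ.move q) := by
  obtain ⟨V, hV, hne, -, rfl⟩ := h
  exact σ.move_isOpen _ _ _ hV hne

theorem IsNext.move_nonempty {p q : List (Set X × Set X)} (h : σ.IsNext p q) :
    (σ.move q).Nonempty := by
  obtain ⟨V, hV, hne, -, rfl⟩ := h
  exact σ.move_nonempty _ _ _ hV hne

theorem exists_isNext_subset {p : List (Set X × Set X)} {V : Set X} (hV : IsOpen V)
    (hne : V.Nonempty) (hsub : V ⊆ σ.move p) : ∃ q, σ.IsNext p q ∧ σ.move q ⊆ V :=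
  ⟨_, ⟨V, hV, hne, hsub, rfl⟩, σ.move_subset _ _ _ hV hne⟩

theorem nonempty_iInter_move (hσ : ∀ U V : ℕ → Set X, σ.IsPlay U V → (⋂ n, U n).Nonempty)
    {p : ℕ → List (Set X × Set X)} (h0 : p 0 = []) (hp : ∀ n, σ.IsNext (p n) (p (n + 1))) :
    (⋂ n, σ.move (p n)).Nonempty := by
  choose V hV hne hsub hpV using hp
  refine hσ _ V ⟨fun n => ⟨hV n, hne n, hsub n⟩, fun n => congrArg σ.move ?_⟩
  induction n with
  | zero => exact h0
  | succ n ih => rw [hpV, ih, List.range_succ, List.map_append, ← ih, List.map_singleton]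

end ChoquetStrategy

/-- Let `β` play first `W`, then successively into each dense open set; a point surviving the play
lies in all of them. -/
theorem IsChoquet.baireSpace {X : Type*} [TopologicalSpace X] (hX : IsChoquet X) :
    BaireSpace X := by
  obtain ⟨σ, hσ⟩ := hX
  refine ⟨fun O hO hd => dense_iff_inter_open.2 fun W hW hWne => ?_⟩
  have hW0 : W ⊆ σ.move [] := σ.move_nil ▸ subset_univ W
  obtain ⟨p₁, hp₁, hp₁W⟩ := σ.exists_isNext_subset hW hWne hW0
  have step : ∀ n, ∀ p : {p // IsOpen (σ.move p) ∧ (σ.move p).Nonempty},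
      ∃ q : {p // IsOpen (σ.move p) ∧ (σ.move p).Nonempty},
        σ.IsNext p.1 q.1 ∧ σ.move q.1 ⊆ O n := fun n p => by
    obtain ⟨q, hq, hqO⟩ := σ.exists_isNext_subset (p.2.1.inter (hO n))
      ((hd n).inter_open_nonempty _ p.2.1 p.2.2) inter_subset_left
    exact ⟨⟨q, hq.isOpen_move, hq.move_nonempty⟩, hq, hqO.trans inter_subset_right⟩
  choose f hf hfO using step
  let s : ℕ → {p // IsOpen (σ.move p) ∧ (σ.move p).Nonempty} := fun n =>
    Nat.rec ⟨p₁, hp₁.isOpen_move, hp₁.move_nonempty⟩ f n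
  obtain ⟨x, hx⟩ := σ.nonempty_iInter_move hσ
    (p := fun n => Nat.casesOn n [] fun n => (s n).1) rfl fun n => by
      cases n with
      | zero => exact hp₁
      | succ n => exact hf n (s n)
  have hxs : ∀ n, x ∈ σ.move (s n).1 := fun n => mem_iInter.1 hx (n + 1)
  exact ⟨x, hp₁W (hxs 0), mem_iInter.2 fun n => hfO n (s n) (hxs (n + 1))⟩

/-- A Choquet space with a dense metrizable `Gδ` subset has a dense completely metrizable
subspace. -/
theorem IsChoquet.exists_dense_isCompletelyMetrizableSpace {X : Type*} [TopologicalSpace X]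
    [T0Space X] (hX : IsChoquet X) {G : Set X} (hGd : Dense G) (hGδ : IsGδ G)
    [TopologicalSpace.MetrizableSpace G] :
    ∃ S : Set X, Dense S ∧ TopologicalSpace.IsCompletelyMetrizableSpace S := by
  have := hX.baireSpace
  obtain ⟨σ, hσ⟩ := hX
  obtain ⟨O, hO, rfl⟩ := isGδ_iff_eq_iInter_nat.1 hGδ
  let _ := TopologicalSpace.metrizableSpaceMetric ↥(⋂ n, O n)
  let R : ℕ → List (Set X × Set X) → List (Set X × Set X) → Prop := fun n p q =>
    σ.IsNext p q ∧ σ.move q ⊆ O n ∧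
      ∀ x y : ↥(⋂ n, O n), (x : X) ∈ σ.move q → (y : X) ∈ σ.move q → dist x y < 1 / (n + 1)
  obtain ⟨S, 𝒱, b, hSd, -, h0, h𝒱, hb, huniq, hS⟩ := exists_dense_isGδ_branches σ.move
    (fun _ p => IsOpen (σ.move p)) R (fun _ p hp => hp) [] (σ.move_nil ▸ isOpen_univ)
    σ.move_nil (by
      intro n p hp V hV hne
      obtain ⟨x, ⟨hxV, hxp⟩, hxG⟩ := hGd.inter_open_nonempty _ (hV.inter hp) hne
      obtain ⟨W, hW, hWb⟩ := isOpen_induced_iff.1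
        (Metric.isOpen_ball (x := (⟨x, hxG⟩ : ↥(⋂ n, O n))) (ε := 1 / (n + 1) / 2))
      have hxW : x ∈ W := by
        have : (⟨x, hxG⟩ : ↥(⋂ n, O n)) ∈ Subtype.val ⁻¹' W :=
          hWb ▸ Metric.mem_ball_self (by positivity)
        exact this
      obtain ⟨q, hq, hqsub⟩ := σ.exists_isNext_subset (p := p)
        (((hV.inter hp).inter (hO n)).inter hW) ⟨x, ⟨⟨hxV, hxp⟩, mem_iInter.1 hxG n⟩, hxW⟩
        (fun y hy => hy.1.1.2)
      refine ⟨q, hq.isOpen_move, ⟨hq, fun y hy => (hqsub hy).1.2, fun y z hy hz => ?_⟩,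
        hq.move_nonempty, fun y hy => (hqsub hy).1.1⟩
      have hball : ∀ y : ↥(⋂ n, O n), (y : X) ∈ σ.move q →
          dist y (⟨x, hxG⟩ : ↥(⋂ n, O n)) < 1 / (n + 1) / 2 := fun y hy => by
        have : y ∈ Subtype.val ⁻¹' W := (hqsub hy).2
        rw [hWb] at this
        exact this
      calc dist y z ≤ dist y ⟨x, hxG⟩ + dist z ⟨x, hxG⟩ := dist_triangle_right _ _ _
        _ < 1 / (n + 1) / 2 + 1 / (n + 1) / 2 := add_lt_add (hball y hy) (hball z hz)
        _ = 1 / (n + 1) := add_halves _)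
  have hSG : S ⊆ ⋂ n, O n := fun x hx => mem_iInter.2 fun n =>
    (hb ⟨x, hx⟩ n).2.2.2.1 (hb ⟨x, hx⟩ (n + 1)).2.1
  let _ : TopologicalSpace (List (Set X × Set X)) := ⊥
  have : DiscreteTopology (List (Set X × Set X)) := ⟨rfl⟩
  have hemb : IsEmbedding b := isEmbedding_branch (o := σ.move) (fun x n => h𝒱 n _ (hb x n).1)
    (fun x n => (hb x n).2.1) (fun x y n h => huniq y n _ (hb x n).1 h) fun x U hU hxU => by
      obtain ⟨ε, hε, hball⟩ := Metric.isOpen_iff.1 (hU.preimage continuous_subtype_val)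
        (⟨x, hSG x.2⟩ : ↥(⋂ n, O n)) hxU
      obtain ⟨n, hn⟩ := exists_nat_one_div_lt hε
      refine ⟨n + 1, fun y hy => hball (a := ⟨y, hSG hy.2⟩) (Metric.mem_ball.2 ?_)⟩
      exact ((hb x n).2.2.2.2 ⟨y, hSG hy.2⟩ ⟨x, hSG x.2⟩ hy.1 (hb x (n + 1)).2.1).trans hn
  have hrange : range b = ⋂ n, {c | c n ∈ 𝒱 n ∧ R n (c n) (c (n + 1))} := by
    refine Subset.antisymm ?_ fun c hc => ?_
    · rintro - ⟨x, rfl⟩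
      exact mem_iInter.2 fun n => ⟨(hb x n).1, (hb x n).2.2⟩
    -- The winning strategy is used here: a coherent sequence of positions is a play, so it has a
    -- point in its intersection and comes from `S`.
    · have hc' := fun n => mem_iInter.1 hc n
      obtain ⟨x, hx⟩ := σ.nonempty_iInter_move hσ (p := c)
        (by simpa [h0] using (hc' 0).1) (fun n => (hc' n).2.1)
      rw [mem_iInter] at hx
      refine ⟨⟨x, hS x fun n => ⟨c n, (hc' n).1, hx n⟩⟩, funext fun n => ?_⟩
      exact (huniq _ n _ (hc' n).1 (hx n)).symm
  have hclosed : IsClosed (range b) := by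
    rw [hrange]
    refine isClosed_iInter fun n => ?_
    -- Each condition involves only two consecutive coordinates in a discrete space.
    exact (isClosed_discrete {c : List (Set X × Set X) × List (Set X × Set X) |
      c.1 ∈ 𝒱 n ∧ R n c.1 c.2}).preimage
      ((continuous_apply (A := fun _ : ℕ => List (Set X × Set X)) n).prodMk
        (continuous_apply (A := fun _ : ℕ => List (Set X × Set X)) (n + 1)))
  let _ : UniformSpace (List (Set X × Set X)) := ⊥
  have : TopologicalSpace.IsCompletelyMetrizableSpace (List (Set X × Set X)) := inferInstance
  exact ⟨S, hSd, (IsClosedEmbedding.mk hemb hclosed).IsCompletelyMetrizableSpace⟩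

theorem mainTheorem5 (X : Type u) [TopologicalSpace X] [T35Space X]
    (hX : IsGameDetermined X) :
    (BaireSpace X → IsFragmentable X →
      ∃ S : Set X, Dense S ∧ IsGδ S ∧ TopologicalSpace.MetrizableSpace S) ∧
    (BaireSpace X → IsStegallFor (BaireMetrizableOfDensityLE (topWeight X)) X →
      ∃ S : Set X, Dense S ∧ TopologicalSpace.MetrizableSpace S ∧ BaireSpace S) ∧
    (IsChoquet X → IsStegallFor (BaireMetrizableOfDensityLE (topWeight X)) X →
      ∃ S : Set X, Dense S ∧ TopologicalSpace.IsCompletelyMetrizableSpace S) := by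
  refine ⟨fun _ hfrag => ?_, fun _ hS => ?_, fun hC hS => ?_⟩
  · refine hX.exists_dense_isGδ_metrizable fun Z _ hZ _ Φ hΦ => ?_
    have := hZ.1
    exact hfrag.exists_eq_singleton hΦ
  · obtain ⟨S, hSd, hSδ, hSm⟩ := hX.exists_dense_isGδ_metrizable hS
    exact ⟨S, hSd, hSm, hSδ.baireSpace_of_dense hSd⟩
  · have := hC.baireSpace
    obtain ⟨S, hSd, hSδ, hSm⟩ := hX.exists_dense_isGδ_metrizable hS
    exact hC.exists_dense_isCompletelyMetrizableSpace hSd hSδ
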